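/- Let $N\ge 3$, $m>1$, $\gamma\in[0,2)$ and $\underline C,\overline C>0$, and set $$\lambda=\frac{N-\gamma}{(N-\gamma)(m-1)+2-\gamma},\qquad \theta=\frac{2-\gamma}{N-\gamma}.$$ There exists a constant $C_0>0$, depending only on $N,m,\gamma,\underline C,\overline C$, with the following property. Let $\rho$ be a measurable function on $\mathbb R^N$ with $$\underline C\,(1+|x|)^{-\gamma}\le\rho(x)\le\overline C\,|x|^{-\gamma}\qquad\text{for a.e. }x\in\mathbb R^N,$$ and let $\|\cdot\|_{0,\rho}$ be the norm $$\|f\|_{0,\rho}=\sup_{R\ge1,\ |z|=R}R^{-\frac{\gamma(N-2)}2}\int_{B_{R^{\gamma/2}}(z)}|f(x)|\,\rho(x)\,dx .$$ Let $u\in L^\infty(\mathbb R^N)$ with $u\ge0$ a.e., and suppose that the distributional gradient $\nabla(u^m)$ belongs to $L^2_{\mathrm{loc}}(\mathbb R^N)$, that the distributional Laplacian $\Delta(u^m)$ belongs to $L^1_{\mathrm{loc}}(\mathbb R^N)$, and that for some constant $\Lambda>0$ $$\Delta(u^m)\ge-\Lambda\,\rho\,u\qquad\text{a.e. in }\mathbb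 R^N .$$ Then $$\|u\|_{L^\infty(\mathbb R^N)}\le C_0\left(\Lambda^{\lambda}\,\|u\|_{0,\rho}^{\theta\lambda}+\|u\|_{0,\rho}\right).$$ -/

import Mathlib

open MeasureTheory
open scoped ENNReal ContDiff RealInnerProductSpace

namespace WeightedPME

/-- `ρ` is a measurable weight on `ℝ^N` with
`c₁ (1 + |x|)^{-γ} ≤ ρ(x) ≤ c₂ |x|^{-γ}` for almost every `x`. -/
def IsWeight {N : ℕ} (γ c₁ c₂ : ℝ) (ρ : EuclideanSpace ℝ (Fin N) → ℝ) : Prop :=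
  AEMeasurable ρ volume ∧
    ∀ᵐ x ∂(volume : Measure (EuclideanSpace ℝ (Fin N))),
      c₁ * (1 + ‖x‖) ^ (-γ) ≤ ρ x ∧ ρ x ≤ c₂ * ‖x‖ ^ (-γ)

/-- The norm `‖f‖_{0,ρ}`, with values in `[0, ∞]`: the supremum, over all `R ≥ 1` and all `z` with
`|z| = R`, of `R^{-γ(N-2)/2} ∫_{B_{R^{γ/2}}(z)} |f| ρ dx`. -/
noncomputable def norm0 {N : ℕ} (γ : ℝ) (ρ f : EuclideanSpace ℝ (Fin N) → ℝ) : ℝ≥0∞ :=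
  ⨆ R ∈ Set.Ici (1 : ℝ), ⨆ z ∈ Metric.sphere (0 : EuclideanSpace ℝ (Fin N)) R,
    ENNReal.ofReal (R ^ (-(γ * ((N : ℝ) - 2) / 2))) *
      ∫⁻ x in Metric.ball z (R ^ (γ / 2)), ENNReal.ofReal (|f x| * ρ x)

/-- `G` is the weak (distributional) gradient of `v`, both being locally integrable:
`∫ v ∂_e φ = -∫ φ ⟪G, e⟫` for all `φ ∈ C_c^∞(ℝ^N)` and all directions `e`. -/
def IsWeakGradient {N : ℕ} (v : EuclideanSpace ℝ (Fin N) → ℝ)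
    (G : EuclideanSpace ℝ (Fin N) → EuclideanSpace ℝ (Fin N)) : Prop :=
  LocallyIntegrable v volume ∧ LocallyIntegrable G volume ∧
    ∀ φ : EuclideanSpace ℝ (Fin N) → ℝ, ContDiff ℝ ∞ φ → HasCompactSupport φ →
      ∀ e : EuclideanSpace ℝ (Fin N),
        ∫ x, v x * fderiv ℝ φ x e = -∫ x, φ x * ⟪G x, e⟫

/-- `G ∈ L²_loc(ℝ^N)`: `G` is square integrable on every compact set. -/
def MemL2Loc {N : ℕ} (G : EuclideanSpace ℝ (Fin N) → EuclideanSpace ℝ (Fin N)) : Prop :=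
  ∀ K : Set (EuclideanSpace ℝ (Fin N)), IsCompact K → MemLp G 2 (volume.restrict K)

/-- The distributional Laplacian of the locally integrable function `v` is (represented by) the
locally integrable function `g`: `∫ v Δφ = ∫ g φ` for all `φ ∈ C_c^∞(ℝ^N)`. -/
def IsWeakLaplacian {N : ℕ} (v g : EuclideanSpace ℝ (Fin N) → ℝ) : Prop :=
  LocallyIntegrable v volume ∧ LocallyIntegrable g volume ∧
    ∀ φ : EuclideanSpace ℝ (Fin N) → ℝ, ContDiff ℝ ∞ φ → HasCompactSupport φ →
      ∫ x, v x * Laplacian.laplacian φ x = ∫ x, g x * φ x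

/-- The exponent `λ = (N - γ) / ((N - γ)(m - 1) + 2 - γ)`. -/
noncomputable def lam (N : ℕ) (m γ : ℝ) : ℝ :=
  ((N : ℝ) - γ) / (((N : ℝ) - γ) * (m - 1) + 2 - γ)

/-- The exponent `θ = (2 - γ) / (N - γ)`. -/
noncomputable def theta (N : ℕ) (γ : ℝ) : ℝ :=
  (2 - γ) / ((N : ℝ) - γ)

end WeightedPME

/-!
Write `w = u ^ m` and let `S` be the essential supremum of `u`, which is finite by assumption, and
`M` the norm `‖u‖_{0,ρ}`. No iteration is needed: the mean value inequality for `Δw ≥ -Λ ρ u`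
bounds `S` by a quantity in which powers of `S` lower than `S ^ m` can be absorbed.

Testing the equation with a smooth truncation of the regularized fundamental solution
(`exists_test_function`) gives, at almost every `x₀` and for every radius `r`,
`w(x₀) ≤ C (r^{-N} ∫_{B_r(x₀)} w + Λ ∫_{B_r(x₀)} ρ u |x - x₀|^{2-N})`
(`exists_pointwise_mean_value`).

The radius is taken to be `b / N` with `b = max(1, |x₀|)^{γ/2}`. At this scale `ρ` is at least of
order `b^{-2}`, and the norm controls the mass of `ρ u` by `b^{N-2} M`, so the average of
`w ≤ S^{m-1} u` is at most a constant times `S^{m-1} M`. The potential is split at the distance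
`σ = b τ` from `x₀`. The outer part is at most `σ^{2-N}` times the mass. In the inner part `u ≤ S`,
and `ρ |x - x₀|^{2-N}` is bounded by `b^{γ-2}` times kernels of homogeneity `2 - N - γ`, whose mass
on balls of radius `σ` is of order `σ^{2-γ}`. All powers of `b` cancel and the potential is at most
a constant times `S τ^{2-γ} + τ^{2-N} M` (`exists_local_estimates`).

The choice `τ^{N-γ} = M / S` balances the two terms and yields
`S^m ≤ C (S^{m-1} M + Λ S^{1-θ} M^θ)`. Depending on which term dominates, `S` is at most a constant
times `M` or times `(Λ M^θ)^{1/(m-1+θ)}`, and `λ = 1/(m-1+θ)` (`le_of_rpow_le`).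
-/

namespace WeightedPME

/-! ### Radial functions and a smooth cutoff -/

/-- The Laplacian of a radial function, written as a profile `H` of the squared scaled distance
`t = (‖x - x₀‖ / r)²`. -/
lemma laplacian_radial {N : ℕ} {H H' H'' : ℝ → ℝ}
    (h1 : ∀ t, 0 ≤ t → HasDerivAt H (H' t) t) (h2 : ∀ t, 0 ≤ t → HasDerivAt H' (H'' t) t)
    (x₀ : EuclideanSpace ℝ (Fin N)) {r : ℝ} (hr : 0 < r) (x : EuclideanSpace ℝ (Fin N)) :
    Laplacian.laplacian (fun y => H ((r ^ 2)⁻¹ * ‖y - x₀‖ ^ 2)) x =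
      (r ^ 2)⁻¹ * (4 * ((r ^ 2)⁻¹ * ‖x - x₀‖ ^ 2) * H'' ((r ^ 2)⁻¹ * ‖x - x₀‖ ^ 2) +
        2 * N * H' ((r ^ 2)⁻¹ * ‖x - x₀‖ ^ 2)) := by
  set k := (r ^ 2)⁻¹
  have hk0 : 0 < k := inv_pos.2 (by positivity)
  have hq : ∀ y : EuclideanSpace ℝ (Fin N), HasFDerivAt (fun y => k * ‖y - x₀‖ ^ 2)
      (k • (2 • (innerSL ℝ (y - x₀)))) y := by
    intro y
    have := ((hasFDerivAt_id y).sub_const x₀).norm_sq.const_mul k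
    simpa using this
  have hf : ∀ y : EuclideanSpace ℝ (Fin N), HasFDerivAt (fun y => H (k * ‖y - x₀‖ ^ 2))
      (H' (k * ‖y - x₀‖ ^ 2) • (k • (2 • (innerSL ℝ (y - x₀))))) y := fun y =>
    (h1 _ (by positivity)).comp_hasFDerivAt y (hq y)
  have hfd : fderiv ℝ (fun y => H (k * ‖y - x₀‖ ^ 2)) = fun y =>
      (H' (k * ‖y - x₀‖ ^ 2) • (k • (2 • (innerSL ℝ (y - x₀))))) := funext fun y => (hf y).fderiv
  have hlin : HasFDerivAt (fun y : EuclideanSpace ℝ (Fin N) => k • (2 • (innerSL ℝ (y - x₀))))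
      (k • (2 • (innerSL ℝ : EuclideanSpace ℝ (Fin N) →L[ℝ] _))) x := by
    have h := ((hasFDerivAt_id (𝕜 := ℝ) x).sub_const x₀)
    have h3 := ((innerSL ℝ : EuclideanSpace ℝ (Fin N) →L[ℝ] _).hasFDerivAt
      (x := x - x₀)).comp x h
    exact (h3.const_smul 2).const_smul k
  have hff := ((h2 (k * ‖x - x₀‖ ^ 2) (by positivity)).comp_hasFDerivAt x (hq x)).smul hlin
  rw [congrFun (InnerProductSpace.laplacian_eq_iteratedFDeriv_orthonormalBasis
    (fun y => H (k * ‖y - x₀‖ ^ 2)) (EuclideanSpace.basisFun (Fin N) ℝ)) x]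
  simp only [iteratedFDeriv_two_apply, hfd]
  have hff' : fderiv ℝ (fun y : EuclideanSpace ℝ (Fin N) =>
      (H' (k * ‖y - x₀‖ ^ 2) • (k • (2 • (innerSL ℝ (y - x₀)))))) x = _ := hff.fderiv
  simp only [hff']
  have hs : ∑ i, (⟪x - x₀, EuclideanSpace.basisFun (Fin N) ℝ i⟫) ^ 2 = ‖x - x₀‖ ^ 2 := by
    rw [EuclideanSpace.norm_sq_eq]
    simp [EuclideanSpace.inner_single_right]
  have hterm : ∀ i : Fin N, ∀ (α β : ℝ),
      ((α • k • 2 • (innerSL ℝ : EuclideanSpace ℝ (Fin N) →L[ℝ] _)) +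
        (β • k • 2 • innerSL ℝ (x - x₀)).smulRight (k • 2 • innerSL ℝ (x - x₀)))
        (EuclideanSpace.basisFun (Fin N) ℝ i) (EuclideanSpace.basisFun (Fin N) ℝ i) =
      2 * k * α + 4 * k ^ 2 * β * ⟪x - x₀, EuclideanSpace.basisFun (Fin N) ℝ i⟫ ^ 2 := by
    intro i α β
    have h1 : ⟪EuclideanSpace.basisFun (Fin N) ℝ i, EuclideanSpace.basisFun (Fin N) ℝ i⟫ = 1 := by
      rw [real_inner_self_eq_norm_sq, (EuclideanSpace.basisFun (Fin N) ℝ).norm_eq_one]; norm_num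
    set e := EuclideanSpace.basisFun (Fin N) ℝ i
    change α * (k * (2 • ⟪e, e⟫)) + (β * (k * (2 • ⟪x - x₀, e⟫))) * (k * (2 • ⟪x - x₀, e⟫)) = _
    rw [h1]
    simp only [nsmul_eq_mul]
    push_cast
    ring
  simp only [Matrix.cons_val_zero, Matrix.cons_val_one, hterm]
  rw [Finset.sum_add_distrib, ← Finset.mul_sum Finset.univ _ (4 * k ^ 2 * _), hs]
  simp only [Finset.sum_const, Finset.card_univ, Fintype.card_fin, nsmul_eq_mul,
    Function.comp_apply]
  ring

/-- A smooth cutoff on the line, equal to `1` for `t ≤ 1/2` and to `0` for `t ≥ 3/4`. -/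
noncomputable def cutoff (t : ℝ) : ℝ := Real.smoothTransition (3 - 4 * t)

lemma cutoff_contDiff : ContDiff ℝ ∞ cutoff := by
  unfold cutoff
  exact Real.smoothTransition.contDiff.comp (by fun_prop)

lemma cutoff_nonneg (t : ℝ) : 0 ≤ cutoff t := Real.smoothTransition.nonneg _

lemma cutoff_le_one (t : ℝ) : cutoff t ≤ 1 := Real.smoothTransition.le_one _

lemma cutoff_eq_one {t : ℝ} (ht : t ≤ 1 / 2) : cutoff t = 1 :=
  Real.smoothTransition.one_of_one_le (by linarith)

lemma cutoff_eq_zero {t : ℝ} (ht : 3 / 4 ≤ t) : cutoff t = 0 :=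
  Real.smoothTransition.zero_of_nonpos (by linarith)

lemma deriv_cutoff_eq_zero {t : ℝ} (ht : t < 1 / 2 ∨ 3 / 4 < t) :
    deriv cutoff t = 0 ∧ deriv (deriv cutoff) t = 0 := by
  have key : ∃ c : ℝ, cutoff =ᶠ[nhds t] fun _ => c := by
    rcases ht with ht | ht
    · exact ⟨1, by filter_upwards [Iio_mem_nhds ht] with s hs using cutoff_eq_one hs.le⟩
    · exact ⟨0, by filter_upwards [Ioi_mem_nhds ht] with s hs using cutoff_eq_zero hs.le⟩
  obtain ⟨c, hc⟩ := key
  constructor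
  · rw [hc.deriv_eq]; simp
  · rw [hc.deriv.deriv_eq]; simp

lemma exists_bound_deriv_cutoff :
    ∃ B : ℝ, 0 < B ∧ ∀ t, |deriv cutoff t| ≤ B ∧ |deriv (deriv cutoff) t| ≤ B := by
  have c1 : ContDiff ℝ ∞ (deriv cutoff) := (contDiff_infty_iff_deriv.1 cutoff_contDiff).2
  have c2 : ContDiff ℝ ∞ (deriv (deriv cutoff)) := (contDiff_infty_iff_deriv.1 c1).2
  obtain ⟨B1, hB1⟩ := isCompact_Icc.exists_bound_of_continuousOn
    (s := Set.Icc (1 / 2 : ℝ) (3 / 4)) c1.continuous.continuousOn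
  obtain ⟨B2, hB2⟩ := isCompact_Icc.exists_bound_of_continuousOn
    (s := Set.Icc (1 / 2 : ℝ) (3 / 4)) c2.continuous.continuousOn
  refine ⟨max 1 (max B1 B2), by positivity, fun t => ?_⟩
  by_cases ht : t ∈ Set.Icc (1 / 2 : ℝ) (3 / 4)
  · have h1 := hB1 t ht
    have h2 := hB2 t ht
    rw [Real.norm_eq_abs] at h1 h2
    exact ⟨h1.trans (by simp), h2.trans (by simp)⟩
  · have : t < 1 / 2 ∨ 3 / 4 < t := by
      by_contra! h
      exact ht h
    obtain ⟨h1, h2⟩ := deriv_cutoff_eq_zero this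
    rw [h1, h2]
    simp

/-! ### Truncated fundamental solutions as test functions -/

/-- The one-variable profile of the test functions: the regularized fundamental solution
`(t + δ)^{(2-N)/2}`, as a function of `t = |x|²`, times the cutoff. For `t ≤ 1/2` the
Laplacian `4 t H'' + 2 N H'` equals `-N (N - 2) δ (t + δ)^{-(N+2)/2}`, an approximate identity;
the remaining terms live in `1/2 ≤ t ≤ 3/4` and are bounded independently of `δ`. -/
lemma exists_radial_profile {N : ℕ} (hN : 3 ≤ N) :
    ∃ C : ℝ, 0 < C ∧ ∀ δ : ℝ, 0 < δ → δ ≤ 1 / 4 → ∃ H H' H'' : ℝ → ℝ,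
      (∀ t, 0 ≤ t → ContDiffAt ℝ ∞ H t) ∧
      (∀ t, 0 ≤ t → HasDerivAt H (H' t) t) ∧ (∀ t, 0 ≤ t → HasDerivAt H' (H'' t) t) ∧
      (∀ t, 0 ≤ t → 0 ≤ H t) ∧ (∀ t, 0 < t → H t ≤ t ^ ((2 - N : ℝ) / 2)) ∧
      (∀ t, 3 / 4 ≤ t → H t = 0) ∧
      (∀ t, 0 ≤ t → 4 * t * H'' t + 2 * N * H' t ≤
        (if t < 1 then C else 0) - (if t ≤ δ then C⁻¹ * δ ^ (-(N : ℝ) / 2) else 0)) := by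
  obtain ⟨B, hB0, hB⟩ := exists_bound_deriv_cutoff
  have hN' : (3 : ℝ) ≤ N := by exact_mod_cast hN
  set a : ℝ := (2 - N : ℝ) / 2 with ha
  have ha0 : a < 0 := by rw [ha]; linarith
  have c1 : ContDiff ℝ ∞ (deriv cutoff) := (contDiff_infty_iff_deriv.1 cutoff_contDiff).2
  set K : ℝ := 8 * |a| * (1 / 2 : ℝ) ^ (a - 1) + 2 * N * (1 / 2 : ℝ) ^ a + 4 * (1 / 2 : ℝ) ^ a
    with hK
  have hK0 : 0 < K := by positivity
  set c : ℝ := N * (N - 2) * (2 : ℝ) ^ (-((N : ℝ) + 2) / 2) with hc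
  have hc0 : 0 < c := by
    have : (0 : ℝ) < N - 2 := by linarith
    positivity
  refine ⟨max (B * K) c⁻¹, by positivity, fun δ hδ hδ4 => ?_⟩
  have hp : ∀ (b t : ℝ), 0 ≤ t → HasDerivAt (fun t => (t + δ) ^ b) (b * (t + δ) ^ (b - 1)) t := by
    intro b t ht
    have := ((hasDerivAt_id t).add_const δ).rpow_const (p := b) (Or.inl (by simp; positivity))
    simpa using this
  have hχ : ∀ t, HasDerivAt cutoff (deriv cutoff t) t := fun t =>
    (cutoff_contDiff.differentiable (by simp) t).hasDerivAt
  have hχ' : ∀ t, HasDerivAt (deriv cutoff) (deriv (deriv cutoff) t) t := fun t =>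
    (c1.differentiable (by simp) t).hasDerivAt
  refine ⟨fun t => (t + δ) ^ a * cutoff t,
    fun t => a * (t + δ) ^ (a - 1) * cutoff t + (t + δ) ^ a * deriv cutoff t,
    fun t => a * ((a - 1) * (t + δ) ^ (a - 1 - 1)) * cutoff t +
      a * (t + δ) ^ (a - 1) * deriv cutoff t +
      (a * (t + δ) ^ (a - 1) * deriv cutoff t + (t + δ) ^ a * deriv (deriv cutoff) t),
    ?_, ?_, ?_, ?_, ?_, ?_, ?_⟩
  · intro t ht
    refine ContDiffAt.mul ?_ cutoff_contDiff.contDiffAt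
    exact (contDiffAt_id.add contDiffAt_const).rpow_const_of_ne (by simp; positivity)
  · intro t ht
    exact (hp a t ht).mul (hχ t)
  · intro t ht
    exact (((hp (a - 1) t ht).const_mul a).mul (hχ t)).add ((hp a t ht).mul (hχ' t))
  · intro t ht
    exact mul_nonneg (by positivity) (cutoff_nonneg t)
  · intro t ht
    calc (t + δ) ^ a * cutoff t ≤ (t + δ) ^ a * 1 := by
          gcongr; exact cutoff_le_one t
      _ ≤ t ^ a := by
          rw [mul_one]
          exact Real.rpow_le_rpow_of_nonpos ht (by linarith) ha0.le
  · intro t ht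
    simp [cutoff_eq_zero ht]
  · intro t ht
    have htδ : 0 < t + δ := by positivity
    -- the part of the Laplacian not involving derivatives of the cutoff
    have hmain : 4 * t * (a * ((a - 1) * (t + δ) ^ (a - 1 - 1))) + 2 * N * (a * (t + δ) ^ (a - 1))
        = -(N * (N - 2) * δ * (t + δ) ^ (a - 1 - 1)) := by
      rw [Real.rpow_sub_one htδ.ne' (a - 1), ha]
      field_simp
      ring
    set Q : ℝ := deriv cutoff t * (8 * t * a * (t + δ) ^ (a - 1) + 2 * N * (t + δ) ^ a) +
      4 * t * deriv (deriv cutoff) t * (t + δ) ^ a with hQ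
    have hsplit : 4 * t * (a * ((a - 1) * (t + δ) ^ (a - 1 - 1)) * cutoff t +
        a * (t + δ) ^ (a - 1) * deriv cutoff t +
        (a * (t + δ) ^ (a - 1) * deriv cutoff t + (t + δ) ^ a * deriv (deriv cutoff) t)) +
        2 * N * (a * (t + δ) ^ (a - 1) * cutoff t + (t + δ) ^ a * deriv cutoff t) =
        -(N * (N - 2) * δ * (t + δ) ^ (a - 1 - 1)) * cutoff t + Q := by
      rw [← hmain, hQ]; ring
    change 4 * t * (_ + _ + _) + 2 * N * (_ + _) ≤ _
    rw [hsplit]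
    have hN2 : (0 : ℝ) < N - 2 := by linarith
    have hpos : 0 ≤ N * (N - 2) * δ * (t + δ) ^ (a - 1 - 1) := by positivity
    have hpow : δ * (δ + δ) ^ (a - 1 - 1) = (2 : ℝ) ^ (-((N : ℝ) + 2) / 2) * δ ^ (-(N : ℝ) / 2) := by
      rw [← two_mul, Real.mul_rpow (by norm_num) hδ.le]
      have e1 : a - 1 - 1 = -((N : ℝ) + 2) / 2 := by rw [ha]; ring
      rw [e1, mul_left_comm]
      congr 1
      rw [← Real.rpow_one_add' hδ.le (by linarith)]
      congr 1; ring
    by_cases htd : t ≤ δ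
    · have hQ0 : Q = 0 := by
        obtain ⟨h1, h2⟩ := deriv_cutoff_eq_zero (t := t) (Or.inl (by linarith))
        rw [hQ, h1, h2]; ring
      rw [hQ0, cutoff_eq_one (by linarith), if_pos (by linarith), if_pos htd]
      have h1 : c * δ ^ (-(N : ℝ) / 2) ≤ N * (N - 2) * δ * (t + δ) ^ (a - 1 - 1) := by
        rw [hc, mul_assoc, ← hpow, ← mul_assoc]
        gcongr N * (N - 2) * δ * ?_
        exact Real.rpow_le_rpow_of_nonpos htδ (by linarith) (by linarith)
      have h2 : (max (B * K) c⁻¹)⁻¹ * δ ^ (-(N : ℝ) / 2) ≤ c * δ ^ (-(N : ℝ) / 2) := by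
        gcongr
        exact inv_le_of_inv_le₀ hc0 (le_max_right _ _)
      have h3 : 0 ≤ max (B * K) c⁻¹ := by positivity
      linarith
    · rw [if_neg htd]
      have hle : -(N * (N - 2) * δ * (t + δ) ^ (a - 1 - 1)) * cutoff t ≤ 0 := by
        have := mul_nonneg hpos (cutoff_nonneg t)
        linarith
      by_cases hr : t < 1 / 2 ∨ 3 / 4 < t
      · have hQ0 : Q = 0 := by
          obtain ⟨h1, h2⟩ := deriv_cutoff_eq_zero (t := t) hr
          rw [hQ, h1, h2]; ring
        rw [hQ0]
        have : 0 ≤ (if t < 1 then max (B * K) c⁻¹ else 0) := by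
          split_ifs <;> positivity
        linarith
      · push Not at hr
        rw [if_pos (by linarith)]
        have hQB : Q ≤ B * K := by
          have p1 : (t + δ) ^ (a - 1) ≤ (1 / 2 : ℝ) ^ (a - 1) :=
            Real.rpow_le_rpow_of_nonpos (by norm_num) (by linarith) (by linarith)
          have p2 : (t + δ) ^ a ≤ (1 / 2 : ℝ) ^ a :=
            Real.rpow_le_rpow_of_nonpos (by norm_num) (by linarith) ha0.le
          have e1 : |8 * t * a * (t + δ) ^ (a - 1) + 2 * N * (t + δ) ^ a| ≤
              8 * |a| * (1 / 2 : ℝ) ^ (a - 1) + 2 * N * (1 / 2 : ℝ) ^ a := by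
            refine (abs_add_le _ _).trans (add_le_add ?_ ?_)
            · rw [abs_mul, abs_mul, abs_mul, abs_of_pos (Real.rpow_pos_of_pos htδ _),
                abs_of_nonneg ht, abs_of_pos (by norm_num : (0 : ℝ) < 8)]
              gcongr ?_ * |a| * ?_
              linarith
            · rw [abs_of_nonneg (by positivity)]
              gcongr
          have e2 : |4 * t * deriv (deriv cutoff) t * (t + δ) ^ a| ≤
              B * (4 * (1 / 2 : ℝ) ^ a) := by
            rw [abs_mul, abs_mul, abs_of_nonneg (by positivity : 0 ≤ 4 * t),
              abs_of_pos (Real.rpow_pos_of_pos htδ _)]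
            calc 4 * t * |deriv (deriv cutoff) t| * (t + δ) ^ a
                ≤ 4 * 1 * B * (1 / 2 : ℝ) ^ a := by
                  gcongr
                  · linarith
                  · exact (hB t).2
              _ = _ := by ring
          calc Q ≤ |Q| := le_abs_self _
            _ ≤ B * (8 * |a| * (1 / 2 : ℝ) ^ (a - 1) + 2 * N * (1 / 2 : ℝ) ^ a) +
                B * (4 * (1 / 2 : ℝ) ^ a) := by
                refine (abs_add_le _ _).trans (add_le_add ?_ e2)
                rw [abs_mul]
                exact mul_le_mul (hB t).1 e1 (abs_nonneg _) hB0.le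
            _ = B * K := by rw [hK]; ring
        have := le_max_left (B * K) c⁻¹
        linarith

/-- Test functions approximating a truncated fundamental solution with pole `x₀`: they are
dominated by `|x - x₀|^{2-N}`, and their Laplacian lies below a negative bump of height `s^{-N}` on
the ball of radius `s` plus an error of size `r^{-N}` on the ball of radius `r`. The bound by
`|x - x₀|^{2-N}` excludes the pole, where the real power is `0`. -/
lemma exists_test_function {N : ℕ} (hN : 3 ≤ N) :
    ∃ C : ℝ, 0 < C ∧ ∀ (x₀ : EuclideanSpace ℝ (Fin N)) (r s : ℝ), 0 < s → 2 * s ≤ r →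
      ∃ φ : EuclideanSpace ℝ (Fin N) → ℝ, ContDiff ℝ ∞ φ ∧ HasCompactSupport φ ∧
        (∀ x, 0 ≤ φ x) ∧ (∀ x, x ≠ x₀ → φ x ≤ ‖x - x₀‖ ^ (2 - N : ℝ)) ∧
        (∀ x, x ∉ Metric.ball x₀ r → φ x = 0) ∧
        (∀ x, Laplacian.laplacian φ x ≤
          (Metric.ball x₀ r).indicator (fun _ => C * r ^ (-(N : ℝ))) x -
            (Metric.closedBall x₀ s).indicator (fun _ => C⁻¹ * s ^ (-(N : ℝ))) x) := by
  classical
  obtain ⟨C, hC, h⟩ := exists_radial_profile hN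
  refine ⟨C, hC, fun x₀ r s hs hsr => ?_⟩
  have hr : 0 < r := by linarith
  have hδ4 : (s / r) ^ 2 ≤ 1 / 4 := by
    have : s / r ≤ 1 / 2 := by rw [div_le_iff₀ hr]; linarith
    calc (s / r) ^ 2 ≤ (1 / 2) ^ 2 := by gcongr
      _ = 1 / 4 := by norm_num
  obtain ⟨H, H', H'', hsm, hd1, hd2, hH0, hHle, hHz, hlap⟩ := h ((s / r) ^ 2) (by positivity) hδ4
  set A : ℝ := r ^ (2 - N : ℝ) with hA
  have hA0 : 0 < A := by positivity
  have hcont : ContDiff ℝ ∞ (fun x : EuclideanSpace ℝ (Fin N) =>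
      A * H ((r ^ 2)⁻¹ * ‖x - x₀‖ ^ 2)) := by
    refine contDiff_const.mul (contDiff_iff_contDiffAt.2 fun x => ?_)
    refine ContDiffAt.comp x (hsm _ (by positivity)) ?_
    exact (contDiff_const.mul ((contDiff_id.sub contDiff_const).norm_sq ℝ)).contDiffAt
  have ht : ∀ x : EuclideanSpace ℝ (Fin N), (r ^ 2)⁻¹ * ‖x - x₀‖ ^ 2 = (‖x - x₀‖ / r) ^ 2 := by
    intro x; rw [div_pow]; ring
  have hzero : ∀ x, x ∉ Metric.ball x₀ r → A * H ((r ^ 2)⁻¹ * ‖x - x₀‖ ^ 2) = 0 := by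
    intro x hx
    rw [Metric.mem_ball, dist_eq_norm, not_lt] at hx
    rw [hHz, mul_zero]
    rw [ht]
    have : 1 ≤ ‖x - x₀‖ / r := by rwa [le_div_iff₀ hr, one_mul]
    nlinarith
  refine ⟨_, hcont, ?_, fun x => ?_, fun x hx => ?_, hzero, fun x => ?_⟩
  · refine HasCompactSupport.intro (isCompact_closedBall x₀ r) fun x hx => hzero x fun hx' =>
      hx (Metric.ball_subset_closedBall hx')
  · exact mul_nonneg hA0.le (hH0 _ (by positivity))
  · have hx0 : 0 < ‖x - x₀‖ := by simpa [sub_eq_zero] using hx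
    calc A * H ((r ^ 2)⁻¹ * ‖x - x₀‖ ^ 2)
        ≤ A * ((‖x - x₀‖ / r) ^ 2) ^ ((2 - N : ℝ) / 2) := by
          rw [ht]
          gcongr
          exact hHle _ (by positivity)
      _ = ‖x - x₀‖ ^ (2 - N : ℝ) := by
          rw [← Real.rpow_natCast, ← Real.rpow_mul (by positivity),
            Real.div_rpow hx0.le hr.le, hA]
          have : ((2 : ℕ) : ℝ) * ((2 - N : ℝ) / 2) = 2 - N := by push_cast; ring
          rw [this]
          field_simp
  · have hl := laplacian_radial (H := fun t => A * H t) (H' := fun t => A * H' t)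
      (H'' := fun t => A * H'' t) (fun t ht => (hd1 t ht).const_mul A)
      (fun t ht => (hd2 t ht).const_mul A) x₀ hr x
    rw [hl]
    have h3 := hlap ((r ^ 2)⁻¹ * ‖x - x₀‖ ^ 2) (by positivity)
    have hAr : (r ^ 2)⁻¹ * A = r ^ (-(N : ℝ)) := by
      rw [hA, ← Real.rpow_natCast, ← Real.rpow_neg hr.le, ← Real.rpow_add hr]
      congr 1; push_cast; ring
    have hAs : r ^ (-(N : ℝ)) * ((s / r) ^ 2) ^ (-(N : ℝ) / 2) = s ^ (-(N : ℝ)) := by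
      rw [← Real.rpow_natCast (s / r), ← Real.rpow_mul (by positivity), Real.div_rpow hs.le hr.le]
      have : ((2 : ℕ) : ℝ) * (-(N : ℝ) / 2) = -N := by push_cast; ring
      rw [this]
      field_simp
    have i1 : ((r ^ 2)⁻¹ * ‖x - x₀‖ ^ 2 < 1) ↔ x ∈ Metric.ball x₀ r := by
      rw [ht, sq_lt_one_iff₀ (by positivity), div_lt_one hr, Metric.mem_ball, dist_eq_norm]
    have i2 : ((r ^ 2)⁻¹ * ‖x - x₀‖ ^ 2 ≤ (s / r) ^ 2) ↔ x ∈ Metric.closedBall x₀ s := by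
      rw [ht, sq_le_sq₀ (by positivity) (by positivity), div_le_div_iff_of_pos_right hr,
        Metric.mem_closedBall, dist_eq_norm]
    calc _ = r ^ (-(N : ℝ)) * (4 * ((r ^ 2)⁻¹ * ‖x - x₀‖ ^ 2) * H'' ((r ^ 2)⁻¹ * ‖x - x₀‖ ^ 2) +
          2 * N * H' ((r ^ 2)⁻¹ * ‖x - x₀‖ ^ 2)) := by rw [← hAr]; ring
      _ ≤ r ^ (-(N : ℝ)) * _ := mul_le_mul_of_nonneg_left h3 (by positivity)
      _ = _ := by
        simp only [Set.indicator_apply, i1, i2]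
        rw [mul_sub, mul_ite, mul_ite, mul_zero, ← hAs]
        congr 1
        · split_ifs <;> ring
        · split_ifs <;> ring

/-! ### The mean value inequality -/

lemma ofReal_integral_le_lintegral_ofReal {α : Type*} [MeasurableSpace α] (μ : Measure α)
    (f : α → ℝ) : ENNReal.ofReal (∫ x, f x ∂μ) ≤ ∫⁻ x, ENNReal.ofReal (f x) ∂μ := by
  by_cases hf : Integrable f μ
  · calc ENNReal.ofReal (∫ x, f x ∂μ) ≤ ENNReal.ofReal (∫ x, max (f x) 0 ∂μ) :=
        ENNReal.ofReal_le_ofReal (integral_mono hf hf.pos_part fun x => le_max_left _ _)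
      _ = ∫⁻ x, ENNReal.ofReal (max (f x) 0) ∂μ :=
        ofReal_integral_eq_lintegral_ofReal hf.pos_part
          (Filter.Eventually.of_forall fun x => le_max_right _ _)
      _ = _ := by simp
  · simp [integral_undef hf]

/-- Mean value inequality for `Δw ≥ -F`: averages over small balls are controlled by the average
over a large ball and the Newtonian potential of `F`. -/
lemma exists_ball_mean_value {N : ℕ} (hN : 3 ≤ N) :
    ∃ C : ℝ, 0 < C ∧ ∀ (w g F : EuclideanSpace ℝ (Fin N) → ℝ), IsWeakLaplacian w g →
      (∀ᵐ x, 0 ≤ w x) → (∀ᵐ x, -F x ≤ g x) → (∀ᵐ x, 0 ≤ F x) →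
      ∀ (x₀ : EuclideanSpace ℝ (Fin N)) (r s P : ℝ), 0 < s → 2 * s ≤ r → 0 ≤ P →
        ∫⁻ x in Metric.ball x₀ r, ENNReal.ofReal (F x * ‖x - x₀‖ ^ (2 - N : ℝ)) ≤
          ENNReal.ofReal P →
        s ^ (-(N : ℝ)) * ∫ x in Metric.closedBall x₀ s, w x ≤
          C * (r ^ (-(N : ℝ)) * (∫ x in Metric.ball x₀ r, w x) + P) := by
  classical
  obtain ⟨C, hC, h⟩ := exists_test_function hN
  refine ⟨C * (C + 1), by positivity, fun w g F hwg hw hFg hF x₀ r s P hs hsr hP hFP => ?_⟩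
  obtain ⟨φ, hsm, hcs, hφ0, hφle, hφz, hφlap⟩ := h x₀ r s hs hsr
  obtain ⟨hwi, hgi, heq⟩ := hwg
  have hball : IntegrableOn w (Metric.ball x₀ r) :=
    (hwi.integrableOn_isCompact (isCompact_closedBall x₀ r)).mono_set Metric.ball_subset_closedBall
  have hcball : IntegrableOn w (Metric.closedBall x₀ s) :=
    hwi.integrableOn_isCompact (isCompact_closedBall x₀ s)
  have i1 : Integrable ((Metric.ball x₀ r).indicator fun x => C * r ^ (-(N : ℝ)) * w x) :=
    (integrable_indicator_iff measurableSet_ball).2 (hball.const_mul _)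
  have i2 : Integrable ((Metric.closedBall x₀ s).indicator fun x => C⁻¹ * s ^ (-(N : ℝ)) * w x) :=
    (integrable_indicator_iff measurableSet_closedBall).2 (hcball.const_mul _)
  have hlapc : Continuous (Laplacian.laplacian φ) := by
    rw [InnerProductSpace.laplacian_eq_iteratedFDeriv_stdOrthonormalBasis]
    refine continuous_finsetSum _ fun i _ => ?_
    exact (ContinuousMultilinearMap.apply ℝ (fun _ : Fin 2 => EuclideanSpace ℝ (Fin N)) ℝ
      _).continuous.comp (hsm.continuous_iteratedFDeriv (m := 2) (by exact WithTop.coe_le_coe.2 le_top))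
  have hlapcs : HasCompactSupport (Laplacian.laplacian φ) := by
    refine HasCompactSupport.intro hcs fun x hx => ?_
    have : φ =ᶠ[nhds x] fun _ => (0 : ℝ) := notMem_tsupport_iff_eventuallyEq.1 hx
    rw [(InnerProductSpace.laplacian_congr_nhds this).eq_of_nhds]
    simp [InnerProductSpace.laplacian_const]
  have i3 : Integrable fun x => w x * Laplacian.laplacian φ x := by
    have := hwi.integrable_smul_right_of_hasCompactSupport hlapc hlapcs
    simpa [mul_comm] using this
  have hint : ∫ x, w x * Laplacian.laplacian φ x ≤
      ∫ x, (Metric.ball x₀ r).indicator (fun x => C * r ^ (-(N : ℝ)) * w x) x -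
        (Metric.closedBall x₀ s).indicator (fun x => C⁻¹ * s ^ (-(N : ℝ)) * w x) x := by
    refine integral_mono_ae i3 (i1.sub i2) ?_
    filter_upwards [hw] with x hx
    refine (mul_le_mul_of_nonneg_left (hφlap x) hx).trans_eq ?_
    simp only [Set.indicator_apply]
    split_ifs <;> ring
  rw [integral_sub i1 i2, integral_indicator measurableSet_ball,
    integral_indicator measurableSet_closedBall, integral_const_mul, integral_const_mul,
    heq φ hsm hcs] at hint
  -- the right-hand side of the equation is controlled by the potential of `F`
  have hpot : ∫ x, -(g x * φ x) ≤ P := by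
    rw [← ENNReal.ofReal_le_ofReal_iff hP]
    refine (ofReal_integral_le_lintegral_ofReal _ _).trans (le_trans ?_ hFP)
    rw [← lintegral_indicator measurableSet_ball]
    refine lintegral_mono_ae ?_
    have hne : ∀ᵐ x : EuclideanSpace ℝ (Fin N), x ≠ x₀ := by
      have : Nonempty (Fin N) := ⟨⟨0, by omega⟩⟩
      exact Measure.ae_ne volume x₀
    filter_upwards [hFg, hF, hne] with x hx hFx hxne
    by_cases hxb : x ∈ Metric.ball x₀ r
    · rw [Set.indicator_of_mem hxb]
      apply ENNReal.ofReal_le_ofReal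
      calc -(g x * φ x) = -g x * φ x := by ring
        _ ≤ F x * φ x := mul_le_mul_of_nonneg_right (by linarith) (hφ0 x)
        _ ≤ _ := mul_le_mul_of_nonneg_left (hφle x hxne) hFx
    · rw [hφz x hxb]
      simp
  rw [integral_neg] at hpot
  have hI : 0 ≤ r ^ (-(N : ℝ)) * ∫ x in Metric.ball x₀ r, w x := by
    have : 0 < r := by linarith
    exact mul_nonneg (by positivity) (setIntegral_nonneg_of_ae hw)
  have h1 : C⁻¹ * (s ^ (-(N : ℝ)) * ∫ x in Metric.closedBall x₀ s, w x) ≤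
      (C + 1) * (r ^ (-(N : ℝ)) * (∫ x in Metric.ball x₀ r, w x) + P) := by
    nlinarith [mul_nonneg hC.le hP]
  rw [inv_mul_le_iff₀ hC] at h1
  linarith

/-- The pointwise form of the mean value inequality, at Lebesgue points of `w`. -/
lemma exists_pointwise_mean_value {N : ℕ} (hN : 3 ≤ N) :
    ∃ C : ℝ, 0 < C ∧ ∀ (w g F : EuclideanSpace ℝ (Fin N) → ℝ), IsWeakLaplacian w g →
      (∀ᵐ x, 0 ≤ w x) → (∀ᵐ x, -F x ≤ g x) → (∀ᵐ x, 0 ≤ F x) →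
      ∀ᵐ x₀ : EuclideanSpace ℝ (Fin N), ∀ r P : ℝ, 0 < r → 0 ≤ P →
        ∫⁻ x in Metric.ball x₀ r, ENNReal.ofReal (F x * ‖x - x₀‖ ^ (2 - N : ℝ)) ≤
          ENNReal.ofReal P →
        w x₀ ≤ C * (r ^ (-(N : ℝ)) * (∫ x in Metric.ball x₀ r, w x) + P) := by
  obtain ⟨C, hC, h⟩ := exists_ball_mean_value hN
  have : Nonempty (Fin N) := ⟨⟨0, by omega⟩⟩
  set κ : ℝ := volume.real (Metric.ball (0 : EuclideanSpace ℝ (Fin N)) 1) with hκ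
  have hκ0 : 0 < κ := ENNReal.toReal_pos (Metric.measure_ball_pos _ _ one_pos).ne'
    measure_ball_lt_top.ne
  refine ⟨κ⁻¹ * C, by positivity, fun w g F hwg hw hFg hF => ?_⟩
  filter_upwards [IsUnifLocDoublingMeasure.ae_tendsto_average volume hwg.1 1] with x₀ hx₀ r P hr hP
    hFP
  have hlim := hx₀ (l := nhdsWithin (0 : ℝ) (Set.Ioi 0)) (fun _ => x₀) id Filter.tendsto_id
    (by filter_upwards [self_mem_nhdsWithin] with s hs
        exact Metric.mem_closedBall_self (by simpa using (le_of_lt hs)))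
  refine le_of_tendsto hlim ?_
  have hev : ∀ᶠ s : ℝ in nhdsWithin (0 : ℝ) (Set.Ioi 0), s < r / 2 :=
    Filter.Eventually.filter_mono nhdsWithin_le_nhds (Iio_mem_nhds (by positivity))
  filter_upwards [hev, self_mem_nhdsWithin] with s hsr hs
  have hs0 : 0 < s := hs
  have hb := h w g F hwg hw hFg hF x₀ r s P hs0 (by linarith) hP hFP
  have hvol : volume.real (Metric.closedBall x₀ s) = s ^ N * κ := by
    rw [measureReal_def, Measure.addHaar_closedBall volume x₀ hs0.le, ENNReal.toReal_mul,
      ENNReal.toReal_ofReal (by positivity)]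
    simp [hκ, measureReal_def]
  have he : ∀ I : ℝ, (s ^ N * κ)⁻¹ * I = κ⁻¹ * (s ^ (-(N : ℝ)) * I) := by
    intro I
    rw [Real.rpow_neg hs0.le, Real.rpow_natCast, mul_inv]
    ring
  rw [setAverage_eq, id, hvol, smul_eq_mul, he, mul_assoc κ⁻¹]
  exact mul_le_mul_of_nonneg_left hb (by positivity)

/-! ### Mass of small balls and of the singular kernel -/

lemma lintegral_ball_le_of_norm0_le {N : ℕ} {γ M R : ℝ} {ρ u : EuclideanSpace ℝ (Fin N) → ℝ}
    (hM : norm0 γ ρ u ≤ ENNReal.ofReal M) (hR : 1 ≤ R) {z : EuclideanSpace ℝ (Fin N)}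
    (hz : ‖z‖ = R) :
    ∫⁻ x in Metric.ball z (R ^ (γ / 2)), ENNReal.ofReal (|u x| * ρ x) ≤
      ENNReal.ofReal ((R ^ (γ / 2)) ^ (N - 2 : ℝ) * M) := by
  have hR0 : 0 < R := by linarith
  set E : ℝ := R ^ (γ * ((N : ℝ) - 2) / 2) with hE
  have hE0 : 0 < E := by positivity
  have h1 : ENNReal.ofReal (R ^ (-(γ * ((N : ℝ) - 2) / 2))) *
      ∫⁻ x in Metric.ball z (R ^ (γ / 2)), ENNReal.ofReal (|u x| * ρ x) ≤ ENNReal.ofReal M := by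
    refine le_trans ?_ hM
    unfold norm0
    refine le_iSup₂_of_le R hR ?_
    exact le_iSup₂_of_le z (by simpa using hz) le_rfl
  have h2 : (R ^ (γ / 2)) ^ (N - 2 : ℝ) = E := by
    rw [← Real.rpow_mul hR0.le, hE]; congr 1; ring
  have h3 : ENNReal.ofReal E * ENNReal.ofReal (R ^ (-(γ * ((N : ℝ) - 2) / 2))) = 1 := by
    rw [← ENNReal.ofReal_mul hE0.le, hE, ← Real.rpow_add hR0]
    simp
  rw [h2, ENNReal.ofReal_mul hE0.le]
  calc _ = ENNReal.ofReal E * (ENNReal.ofReal (R ^ (-(γ * ((N : ℝ) - 2) / 2))) *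
        ∫⁻ x in Metric.ball z (R ^ (γ / 2)), ENNReal.ofReal (|u x| * ρ x)) := by
        rw [← mul_assoc, h3, one_mul]
    _ ≤ _ := by gcongr

/-- A small ball around the origin, without the origin itself, is covered by the `2N` unit balls
centred at `±eᵢ`. -/
lemma exists_mem_ball_single {N : ℕ} (hN : 3 ≤ N) {x : EuclideanSpace ℝ (Fin N)} (hx : x ≠ 0)
    (hxN : ‖x‖ < 2 / N) :
    ∃ p : Fin N × Bool,
      x ∈ Metric.ball (EuclideanSpace.single p.1 (if p.2 then (1 : ℝ) else -1)) 1 := by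
  by_contra! hcon
  have hN' : (3 : ℝ) ≤ N := by exact_mod_cast hN
  have hx0 : 0 < ‖x‖ := norm_pos_iff.2 hx
  have hdist : ∀ (i : Fin N) (ε : Bool),
      2 * (x i * (if ε then (1 : ℝ) else -1)) ≤ ‖x‖ ^ 2 := by
    intro i ε
    have h := hcon (i, ε)
    rw [Metric.mem_ball, dist_eq_norm, not_lt] at h
    have h1 : (1 : ℝ) ≤ ‖x - EuclideanSpace.single i (if ε then (1 : ℝ) else -1)‖ ^ 2 := by
      nlinarith
    rw [norm_sub_sq_real, EuclideanSpace.inner_single_right, PiLp.norm_single] at h1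
    cases ε <;> simp at h1 ⊢ <;> linarith
  have hcoord : ∀ i, x i ^ 2 ≤ ‖x‖ ^ 4 / 4 := by
    intro i
    have h1 := hdist i true
    have h2 := hdist i false
    simp only [if_true, Bool.false_eq_true, if_false] at h1 h2
    have : |x i| ≤ ‖x‖ ^ 2 / 2 := abs_le.2 ⟨by linarith, by linarith⟩
    calc x i ^ 2 = |x i| ^ 2 := (sq_abs _).symm
      _ ≤ (‖x‖ ^ 2 / 2) ^ 2 := by gcongr
      _ = _ := by ring
  have hsum : ‖x‖ ^ 2 ≤ N * (‖x‖ ^ 4 / 4) := by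
    rw [EuclideanSpace.norm_sq_eq]
    calc ∑ i, ‖x i‖ ^ 2 ≤ ∑ _i : Fin N, ‖x‖ ^ 4 / 4 :=
          Finset.sum_le_sum fun i _ => by simpa using hcoord i
      _ = _ := by
        rw [EuclideanSpace.norm_eq]
        simp
  have h4 : 4 ≤ N * ‖x‖ ^ 2 := by
    have : ‖x‖ ^ 2 * 4 ≤ ‖x‖ ^ 2 * (N * ‖x‖ ^ 2) := by nlinarith
    exact le_of_mul_le_mul_left this (by positivity)
  have h5 : N * ‖x‖ < 2 := by rwa [lt_div_iff₀ (by linarith), mul_comm] at hxN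
  nlinarith

/-- The norm `‖·‖_{0,ρ}` controls the mass on a ball around an arbitrary centre `x₀`, of radius
comparable to `max(1, |x₀|)^{γ/2}`. For `|x₀| < 1` such balls are not contained in a single
admissible ball when `x₀` is close to the origin, and finitely many are used. -/
lemma lintegral_local_ball_le {N : ℕ} (hN : 3 ≤ N) {γ M : ℝ} (hM0 : 0 ≤ M) (hγ0 : 0 ≤ γ)
    {ρ u : EuclideanSpace ℝ (Fin N) → ℝ} (hM : norm0 γ ρ u ≤ ENNReal.ofReal M)
    (x₀ : EuclideanSpace ℝ (Fin N)) :
    ∫⁻ x in Metric.ball x₀ (max 1 ‖x₀‖ ^ (γ / 2) / N), ENNReal.ofReal (|u x| * ρ x) ≤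
      ENNReal.ofReal (2 * N * (max 1 ‖x₀‖ ^ (γ / 2)) ^ (N - 2 : ℝ) * M) := by
  have hN' : (3 : ℝ) ≤ N := by exact_mod_cast hN
  have hNpos : (0 : ℝ) < N := by linarith
  have hb : 1 ≤ max 1 ‖x₀‖ ^ (γ / 2) := Real.one_le_rpow (le_max_left _ _) (by positivity)
  set b := max 1 ‖x₀‖ ^ (γ / 2) with hbdef
  have hbM : 0 ≤ b ^ (N - 2 : ℝ) * M := by positivity
  have h2N : b ^ (N - 2 : ℝ) * M ≤ 2 * N * b ^ (N - 2 : ℝ) * M := by nlinarith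
  by_cases hx1 : 1 ≤ ‖x₀‖
  · rw [max_eq_right hx1] at hbdef
    refine le_trans (lintegral_mono_set (Metric.ball_subset_ball ?_))
      ((lintegral_ball_le_of_norm0_le hM hx1 rfl).trans (ENNReal.ofReal_le_ofReal ?_))
    · rw [← hbdef, div_le_iff₀ hNpos]; nlinarith
    · rwa [← hbdef]
  push Not at hx1
  rw [max_eq_left hx1.le, Real.one_rpow] at hbdef
  rw [hbdef] at h2N hbM ⊢
  rw [Real.one_rpow] at *
  by_cases hx2 : 1 / N ≤ ‖x₀‖
  · have hx0 : 0 < ‖x₀‖ := lt_of_lt_of_le (by positivity) hx2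
    have hz : ‖‖x₀‖⁻¹ • x₀‖ = 1 := by
      rw [norm_smul, norm_inv, norm_norm, inv_mul_cancel₀ hx0.ne']
    have h := lintegral_ball_le_of_norm0_le hM le_rfl hz
    rw [Real.one_rpow, Real.one_rpow] at h
    refine le_trans (lintegral_mono_set (Metric.ball_subset_ball' ?_))
      (h.trans (ENNReal.ofReal_le_ofReal h2N))
    have : dist x₀ (‖x₀‖⁻¹ • x₀) = 1 - ‖x₀‖ := by
      have e : x₀ - ‖x₀‖⁻¹ • x₀ = (1 - ‖x₀‖⁻¹) • x₀ := by rw [sub_smul, one_smul]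
      have : 1 ≤ ‖x₀‖⁻¹ := (one_le_inv₀ hx0).2 hx1.le
      rw [dist_eq_norm, e, norm_smul, Real.norm_eq_abs, abs_of_nonpos (by linarith)]
      field_simp
      ring
    rw [this]
    linarith
  · push Not at hx2
    have : Nonempty (Fin N) := ⟨⟨0, by omega⟩⟩
    have hsub : Metric.ball x₀ (1 / N) \ {0} ⊆ ⋃ p : Fin N × Bool,
        Metric.ball (EuclideanSpace.single p.1 (if p.2 then (1 : ℝ) else -1)) 1 := by
      rintro x ⟨hx, hx0⟩
      refine Set.mem_iUnion.2 (exists_mem_ball_single hN hx0 ?_)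
      rw [Metric.mem_ball, dist_eq_norm] at hx
      calc ‖x‖ = ‖(x - x₀) + x₀‖ := by rw [sub_add_cancel]
        _ ≤ ‖x - x₀‖ + ‖x₀‖ := norm_add_le _ _
        _ < 1 / N + 1 / N := add_lt_add hx hx2
        _ = 2 / N := by ring
    calc _ = ∫⁻ x in Metric.ball x₀ (1 / N) \ {0}, ENNReal.ofReal (|u x| * ρ x) :=
          setLIntegral_congr (sdiff_null_ae_eq_self (measure_singleton 0)).symm
      _ ≤ _ := lintegral_mono_set hsub
      _ ≤ ∑' p : Fin N × Bool,
          ∫⁻ x in Metric.ball (EuclideanSpace.single p.1 (if p.2 then (1 : ℝ) else -1)) 1,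
            ENNReal.ofReal (|u x| * ρ x) := lintegral_iUnion_le _ _
      _ ≤ ∑' _p : Fin N × Bool, ENNReal.ofReal M := by
          refine ENNReal.tsum_le_tsum fun p => ?_
          have h := lintegral_ball_le_of_norm0_le hM le_rfl
            (z := EuclideanSpace.single p.1 (if p.2 then (1 : ℝ) else -1))
            (by rw [PiLp.norm_single]; split_ifs <;> simp)
          rw [Real.one_rpow, Real.one_rpow, one_mul] at h
          exact h
      _ = _ := by
          rw [tsum_fintype, Finset.sum_const, Finset.card_univ, Fintype.card_prod,
            Fintype.card_fin, Fintype.card_bool, nsmul_eq_mul, mul_one,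
            ENNReal.ofReal_mul (by positivity)]
          congr 1
          rw [mul_comm (2 : ℝ), ← ENNReal.ofReal_natCast]
          push_cast
          rfl

/-- The mass of the kernel `|x|^{2-N-γ}` on a ball of radius `σ` around its pole scales like
`σ^{2-γ}`. -/
lemma exists_kernel_bound {N : ℕ} (hN : 3 ≤ N) {γ : ℝ} (hγ2 : γ < 2) :
    ∃ A : ℝ, 0 < A ∧ ∀ (x₀ : EuclideanSpace ℝ (Fin N)) (σ : ℝ), 0 < σ →
      ∫⁻ x in Metric.ball x₀ σ, ENNReal.ofReal (‖x - x₀‖ ^ (2 - N - γ : ℝ)) ≤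
        ENNReal.ofReal (A * σ ^ (2 - γ)) := by
  have : Nonempty (Fin N) := ⟨⟨0, by omega⟩⟩
  have hint : ∀ σ : ℝ, 0 < σ → IntegrableOn
      (fun x : EuclideanSpace ℝ (Fin N) => ‖x‖ ^ (2 - N - γ : ℝ)) (Metric.ball 0 σ) := by
    intro σ hσ
    rw [integrableOn_fun_norm_addHaar volume (f := fun t => t ^ (2 - N - γ : ℝ))]
    have h1 := (intervalIntegral.integrableOn_Ioo_rpow_iff (s := 1 - γ) hσ).2 (by linarith)
    refine h1.congr_fun (fun y hy => ?_) measurableSet_Ioo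
    have hy0 : 0 < y := hy.1
    simp only [finrank_euclideanSpace, Fintype.card_fin, smul_eq_mul]
    rw [← Real.rpow_natCast, ← Real.rpow_add hy0, Nat.cast_sub (by omega)]
    congr 1; push_cast; ring
  set I : ℝ := ∫ x in Metric.ball (0 : EuclideanSpace ℝ (Fin N)) 1, ‖x‖ ^ (2 - N - γ : ℝ) with hI
  have hI0 : 0 ≤ I := integral_nonneg fun x => by positivity
  refine ⟨I + 1, by positivity, fun x₀ σ hσ => ?_⟩
  have htrans : ∫⁻ x in Metric.ball x₀ σ, ENNReal.ofReal (‖x - x₀‖ ^ (2 - N - γ : ℝ)) =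
      ∫⁻ x in Metric.ball (0 : EuclideanSpace ℝ (Fin N)) σ,
        ENNReal.ofReal (‖x‖ ^ (2 - N - γ : ℝ)) := by
    rw [← lintegral_indicator measurableSet_ball, ← lintegral_indicator measurableSet_ball,
      ← lintegral_sub_right_eq_self ((Metric.ball (0 : EuclideanSpace ℝ (Fin N)) σ).indicator _) x₀]
    congr 1 with x
    by_cases hx : x ∈ Metric.ball x₀ σ
    · rw [Set.indicator_of_mem hx, Set.indicator_of_mem]
      simpa [dist_eq_norm] using hx
    · rw [Set.indicator_of_notMem hx, Set.indicator_of_notMem]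
      simpa [dist_eq_norm] using hx
  have hscale : ∫ x in Metric.ball (0 : EuclideanSpace ℝ (Fin N)) σ, ‖x‖ ^ (2 - N - γ : ℝ) =
      I * σ ^ (2 - γ) := by
    have h := Measure.setIntegral_comp_smul_of_pos volume
      (fun x : EuclideanSpace ℝ (Fin N) => ‖x‖ ^ (2 - N - γ : ℝ)) (Metric.ball 0 1) hσ
    rw [smul_unitBall_of_pos hσ, finrank_euclideanSpace, Fintype.card_fin, smul_eq_mul] at h
    have h2 : ∀ x : EuclideanSpace ℝ (Fin N), ‖σ • x‖ ^ (2 - N - γ : ℝ) =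
        σ ^ (2 - N - γ : ℝ) * ‖x‖ ^ (2 - N - γ : ℝ) := by
      intro x
      rw [norm_smul, Real.norm_of_nonneg hσ.le, Real.mul_rpow hσ.le (norm_nonneg _)]
    simp only [h2] at h
    rw [integral_const_mul, ← hI, eq_inv_mul_iff_mul_eq₀ (by positivity)] at h
    rw [← h, ← mul_assoc, ← Real.rpow_natCast, ← Real.rpow_add hσ, mul_comm]
    congr 2; ring
  rw [htrans, ← ofReal_integral_eq_lintegral_ofReal (hint σ hσ)
    (Filter.Eventually.of_forall fun x => by positivity), hscale]
  apply ENNReal.ofReal_le_ofReal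
  gcongr
  linarith

/-! ### Estimates at the natural scale -/

lemma one_le_max_rpow (t : ℝ) {s : ℝ} (hs : 0 ≤ s) : 1 ≤ max 1 t ^ s :=
  Real.one_le_rpow (le_max_left _ _) hs

lemma max_rpow_half_le (t : ℝ) {γ : ℝ} (hγ2 : γ < 2) : max 1 t ^ (γ / 2) ≤ max 1 t := by
  calc max 1 t ^ (γ / 2) ≤ max 1 t ^ (1 : ℝ) :=
        Real.rpow_le_rpow_of_exponent_le (le_max_left _ _) (by linarith)
    _ = _ := Real.rpow_one _

lemma weight_lower_bound {N : ℕ} (hN : 3 ≤ N) {γ c₁ : ℝ} (hγ0 : 0 ≤ γ) (hγ2 : γ < 2)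
    (hc₁ : 0 < c₁) {x₀ x : EuclideanSpace ℝ (Fin N)}
    (hx : x ∈ Metric.ball x₀ (max 1 ‖x₀‖ ^ (γ / 2) / N)) :
    c₁ * 3 ^ (-γ) * (max 1 ‖x₀‖ ^ (γ / 2)) ^ (-2 : ℝ) ≤ c₁ * (1 + ‖x‖) ^ (-γ) := by
  have hN' : (3 : ℝ) ≤ N := by exact_mod_cast hN
  set m := max 1 ‖x₀‖ with hm
  have hm1 : 1 ≤ m := le_max_left _ _
  have hb := max_rpow_half_le ‖x₀‖ hγ2
  rw [← hm] at hb
  have hb1 := one_le_max_rpow ‖x₀‖ (s := γ / 2) (by positivity)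
  rw [← hm] at hb1
  have hr : m ^ (γ / 2) / N ≤ m := (div_le_self (by positivity) (by linarith)).trans hb
  rw [Metric.mem_ball, dist_eq_norm] at hx
  have h1 : 1 + ‖x‖ ≤ 3 * m := by
    have h2 : ‖x‖ ≤ ‖x - x₀‖ + ‖x₀‖ := by
      simpa using norm_add_le (x - x₀) x₀
    have : ‖x₀‖ ≤ m := le_max_right _ _
    linarith
  calc c₁ * 3 ^ (-γ) * (m ^ (γ / 2)) ^ (-2 : ℝ) = c₁ * (3 * m) ^ (-γ) := by
        rw [← Real.rpow_mul (by positivity), Real.mul_rpow (by norm_num) (by positivity), mul_assoc]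
        congr 3; ring
    _ ≤ _ := by
        gcongr c₁ * ?_
        exact Real.rpow_le_rpow_of_nonpos (by positivity) h1 (by linarith)

/-- On the ball around `x₀` of radius comparable to `max(1, |x₀|)^{γ/2}`, the weight times the
Newtonian kernel is bounded by kernels of homogeneity `2 - N - γ`, with poles at `x₀` and at the
origin. The pole at the origin is only needed closer to the origin than to `x₀`. -/
lemma weight_mul_kernel_le {N : ℕ} (hN : 3 ≤ N) {γ c₂ : ℝ} (hγ0 : 0 ≤ γ) (hγ2 : γ < 2)
    (hc₂ : 0 < c₂) {x₀ x : EuclideanSpace ℝ (Fin N)}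
    (hx : x ∈ Metric.ball x₀ (max 1 ‖x₀‖ ^ (γ / 2) / N)) (hx0 : x ≠ 0) (hxx₀ : x ≠ x₀) :
    c₂ * ‖x‖ ^ (-γ) * ‖x - x₀‖ ^ (2 - N : ℝ) ≤
      c₂ * 2 ^ γ * (max 1 ‖x₀‖ ^ (γ / 2)) ^ (γ - 2) *
        ((if ‖x‖ < ‖x - x₀‖ then ‖x‖ ^ (2 - N - γ : ℝ) else 0) +
          ‖x - x₀‖ ^ (2 - N - γ : ℝ)) := by
  have hN' : (3 : ℝ) ≤ N := by exact_mod_cast hN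
  have hn : 0 < ‖x‖ := norm_pos_iff.2 hx0
  have hn' : 0 < ‖x - x₀‖ := norm_pos_iff.2 (sub_ne_zero.2 hxx₀)
  have hsplit : ∀ t : ℝ, 0 < t → t ^ (2 - N - γ : ℝ) = t ^ (-γ) * t ^ (2 - N : ℝ) := by
    intro t ht
    rw [← Real.rpow_add ht]; congr 1; ring
  set k : ℝ := if ‖x‖ < ‖x - x₀‖ then ‖x‖ ^ (2 - N - γ : ℝ) else 0 with hk
  have hk0 : 0 ≤ k := by rw [hk]; split_ifs <;> positivity
  have h2γ : (1 : ℝ) ≤ 2 ^ γ := Real.one_le_rpow (by norm_num) hγ0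
  by_cases hR : 1 ≤ ‖x₀‖
  · -- far from the origin `|x| ≥ |x₀| / 2`, and `|x - x₀|^γ ≤ b^γ` gains the missing homogeneity
    rw [max_eq_right hR] at hx ⊢
    set R := ‖x₀‖ with hRdef
    have hR0 : 0 < R := by linarith
    have hbR : R ^ (γ / 2) ≤ R := by
      have := max_rpow_half_le R hγ2
      rwa [max_eq_right hR] at this
    set b := R ^ (γ / 2) with hb
    have hb0 : 0 < b := by positivity
    rw [Metric.mem_ball, dist_eq_norm] at hx
    have hxb : ‖x - x₀‖ ≤ b := hx.le.trans (div_le_self hb0.le (by linarith))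
    have hx3 : ‖x - x₀‖ ≤ R / 3 := hx.le.trans (by gcongr)
    have hxR : R / 2 ≤ ‖x‖ := by
      have h2 : ‖x₀‖ ≤ ‖x₀ - x‖ + ‖x‖ := by simpa using norm_add_le (x₀ - x) x
      rw [norm_sub_rev] at h2
      linarith
    have h1 : ‖x‖ ^ (-γ) ≤ 2 ^ γ * b ^ (-2 : ℝ) := by
      calc ‖x‖ ^ (-γ) ≤ (R / 2) ^ (-γ) :=
            Real.rpow_le_rpow_of_nonpos (by positivity) hxR (by linarith)
        _ = 2 ^ γ * b ^ (-2 : ℝ) := by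
            rw [hb, ← Real.rpow_mul hR0.le, Real.div_rpow hR0.le (by norm_num),
              Real.rpow_neg (by norm_num : (0 : ℝ) ≤ 2), div_inv_eq_mul, mul_comm]
            congr 2; ring
    have h2 : ‖x - x₀‖ ^ (2 - N : ℝ) ≤ b ^ γ * ‖x - x₀‖ ^ (2 - N - γ : ℝ) := by
      have : ‖x - x₀‖ ^ (2 - N : ℝ) = ‖x - x₀‖ ^ γ * ‖x - x₀‖ ^ (2 - N - γ : ℝ) := by
        rw [← Real.rpow_add hn']; congr 1; ring
      rw [this]
      gcongr
    calc c₂ * ‖x‖ ^ (-γ) * ‖x - x₀‖ ^ (2 - N : ℝ)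
        ≤ c₂ * (2 ^ γ * b ^ (-2 : ℝ)) * (b ^ γ * ‖x - x₀‖ ^ (2 - N - γ : ℝ)) := by gcongr
      _ = c₂ * 2 ^ γ * b ^ (γ - 2) * (0 + ‖x - x₀‖ ^ (2 - N - γ : ℝ)) := by
          have : b ^ (γ - 2) = b ^ (-2 : ℝ) * b ^ γ := by
            rw [← Real.rpow_add hb0]; congr 1; ring
          rw [this]; ring
      _ ≤ _ := by gcongr
  · -- near the origin `b = 1`, and the product is at most the kernel of the nearer pole
    push Not at hR
    rw [max_eq_left hR.le, Real.one_rpow, Real.one_rpow, mul_one]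
    have key : ‖x‖ ^ (-γ) * ‖x - x₀‖ ^ (2 - N : ℝ) ≤ k + ‖x - x₀‖ ^ (2 - N - γ : ℝ) := by
      by_cases hlt : ‖x‖ < ‖x - x₀‖
      · rw [hk, if_pos hlt, hsplit _ hn]
        have : ‖x - x₀‖ ^ (2 - N : ℝ) ≤ ‖x‖ ^ (2 - N : ℝ) :=
          Real.rpow_le_rpow_of_nonpos hn hlt.le (by linarith)
        have h3 : ‖x‖ ^ (-γ) * ‖x - x₀‖ ^ (2 - N : ℝ) ≤ ‖x‖ ^ (-γ) * ‖x‖ ^ (2 - N : ℝ) := by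
          gcongr
        have h4 : 0 ≤ ‖x - x₀‖ ^ (2 - N - γ : ℝ) := by positivity
        linarith
      · rw [hk, if_neg hlt, zero_add, hsplit _ hn']
        gcongr ?_ * _
        exact Real.rpow_le_rpow_of_nonpos hn' (not_lt.1 hlt) (by linarith)
    calc c₂ * ‖x‖ ^ (-γ) * ‖x - x₀‖ ^ (2 - N : ℝ)
        = c₂ * 1 * (‖x‖ ^ (-γ) * ‖x - x₀‖ ^ (2 - N : ℝ)) := by ring
      _ ≤ c₂ * 2 ^ γ * (k + ‖x - x₀‖ ^ (2 - N - γ : ℝ)) := by gcongr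

/-- The two quantities on the right of the mean value inequality, estimated at the natural
radius: the average of `u` by the mass `M`, and the potential of `ρ u`, split at distance
`max(1, |x₀|)^{γ/2} τ` from the pole, by the supremum near the pole and by the mass away from it. -/
lemma exists_local_estimates {N : ℕ} (hN : 3 ≤ N) {γ c₁ c₂ : ℝ} (hγ0 : 0 ≤ γ) (hγ2 : γ < 2)
    (hc₁ : 0 < c₁) (hc₂ : 0 < c₂) :
    ∃ C : ℝ, 0 < C ∧ ∀ (ρ u : EuclideanSpace ℝ (Fin N) → ℝ) (S M : ℝ), IsWeight γ c₁ c₂ ρ →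
      0 ≤ S → 0 ≤ M → (∀ᵐ x, 0 ≤ u x) → (∀ᵐ x, u x ≤ S) → norm0 γ ρ u ≤ ENNReal.ofReal M →
      ∀ x₀ : EuclideanSpace ℝ (Fin N), ∃ r : ℝ, 0 < r ∧
        r ^ (-(N : ℝ)) * (∫ x in Metric.ball x₀ r, u x) ≤ C * M ∧
        ∀ τ : ℝ, 0 < τ →
          ∫⁻ x in Metric.ball x₀ r, ENNReal.ofReal (ρ x * u x * ‖x - x₀‖ ^ (2 - N : ℝ)) ≤
            ENNReal.ofReal (C * (S * τ ^ (2 - γ) + τ ^ (2 - N : ℝ) * M)) := by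
  obtain ⟨A, hA, hker⟩ := exists_kernel_bound hN hγ2
  have hN' : (3 : ℝ) ≤ N := by exact_mod_cast hN
  have hNpos : (0 : ℝ) < N := by linarith
  have : Nonempty (Fin N) := ⟨⟨0, by omega⟩⟩
  set C₁ : ℝ := N ^ (N : ℝ) * ((c₁ * 3 ^ (-γ))⁻¹ * (2 * N)) with hC₁
  set C₂ : ℝ := 2 * (c₂ * 2 ^ γ) * A with hC₂
  have hC₁0 : 0 < C₁ := by positivity
  have hC₂0 : 0 < C₂ := by positivity
  refine ⟨C₁ + C₂ + 2 * N, by positivity, fun ρ u S M hρ hS hM hu0 huS hnorm x₀ => ?_⟩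
  have hmass := lintegral_local_ball_le hN hM hγ0 hnorm x₀
  have hb1 := one_le_max_rpow ‖x₀‖ (s := γ / 2) (by positivity)
  have hlow : ∀ x ∈ Metric.ball x₀ (max 1 ‖x₀‖ ^ (γ / 2) / N), _ :=
    fun x hx => weight_lower_bound hN hγ0 hγ2 hc₁ hx
  have hup : ∀ x ∈ Metric.ball x₀ (max 1 ‖x₀‖ ^ (γ / 2) / N), _ :=
    fun x hx => weight_mul_kernel_le hN hγ0 hγ2 hc₂ hx
  set b := max 1 ‖x₀‖ ^ (γ / 2) with hb
  have hb0 : 0 < b := by linarith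
  have hr0 : 0 < b / N := by positivity
  refine ⟨b / N, hr0, ?_, fun τ hτ => ?_⟩
  · -- the lower bound on `ρ` turns the weighted mass into an unweighted average
    set κ : ℝ := (c₁ * 3 ^ (-γ) * b ^ (-2 : ℝ))⁻¹ with hκ
    have hκ0 : 0 < κ := by positivity
    have h1 : ∫ x in Metric.ball x₀ (b / N), u x ≤ κ * (2 * N * b ^ (N - 2 : ℝ) * M) := by
      rw [← ENNReal.ofReal_le_ofReal_iff (by positivity)]
      refine (ofReal_integral_le_lintegral_ofReal _ _).trans ?_
      rw [ENNReal.ofReal_mul hκ0.le]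
      calc ∫⁻ x in Metric.ball x₀ (b / N), ENNReal.ofReal (u x)
          ≤ ∫⁻ x in Metric.ball x₀ (b / N), ENNReal.ofReal κ * ENNReal.ofReal (|u x| * ρ x) := by
            refine setLIntegral_mono_ae' measurableSet_ball ?_
            filter_upwards [hρ.2, hu0] with x hx hux hxb
            rw [← ENNReal.ofReal_mul hκ0.le, abs_of_nonneg hux]
            apply ENNReal.ofReal_le_ofReal
            have h2 : κ⁻¹ ≤ ρ x := by
              rw [hκ, inv_inv]; exact (hlow x hxb).trans hx.1
            calc u x = κ * (u x * κ⁻¹) := by field_simp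
              _ ≤ κ * (u x * ρ x) := by gcongr
        _ = ENNReal.ofReal κ * ∫⁻ x in Metric.ball x₀ (b / N), ENNReal.ofReal (|u x| * ρ x) :=
            lintegral_const_mul' _ _ ENNReal.ofReal_ne_top
        _ ≤ _ := by gcongr
    calc (b / N) ^ (-(N : ℝ)) * ∫ x in Metric.ball x₀ (b / N), u x
        ≤ (b / N) ^ (-(N : ℝ)) * (κ * (2 * N * b ^ (N - 2 : ℝ) * M)) := by gcongr
      _ = C₁ * M := by
          have e1 : (b / N) ^ (-(N : ℝ)) = b ^ (-(N : ℝ)) * N ^ (N : ℝ) := by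
            rw [Real.div_rpow hb0.le hNpos.le, Real.rpow_neg hNpos.le, div_inv_eq_mul]
          have e2 : κ = (c₁ * 3 ^ (-γ))⁻¹ * b ^ (2 : ℝ) := by
            rw [hκ, mul_inv, Real.rpow_neg hb0.le, inv_inv]
          have e3 : b ^ (-(N : ℝ)) * b ^ (2 : ℝ) * b ^ (N - 2 : ℝ) = 1 := by
            rw [← Real.rpow_add hb0, ← Real.rpow_add hb0]
            ring_nf
            exact Real.rpow_zero _
          rw [e1, e2, hC₁]
          linear_combination (N : ℝ) ^ (N : ℝ) * (c₁ * 3 ^ (-γ))⁻¹ * (2 * N) * M * e3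
      _ ≤ (C₁ + C₂ + 2 * N) * M := by
          gcongr
          linarith
  · set σ : ℝ := b * τ with hσ
    have hσ0 : 0 < σ := by positivity
    set κ : ℝ := S * (c₂ * 2 ^ γ * b ^ (γ - 2)) with hκ
    have hκ0 : 0 ≤ κ := by positivity
    have hne : ∀ᵐ x : EuclideanSpace ℝ (Fin N), x ≠ x₀ := Measure.ae_ne volume x₀
    have hne0 : ∀ᵐ x : EuclideanSpace ℝ (Fin N), x ≠ 0 := Measure.ae_ne volume 0
    set f₀ : EuclideanSpace ℝ (Fin N) → ℝ≥0∞ := (Metric.ball 0 σ).indicator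
      fun x => ENNReal.ofReal κ * ENNReal.ofReal (‖x - 0‖ ^ (2 - N - γ : ℝ)) with hf₀
    set f₁ : EuclideanSpace ℝ (Fin N) → ℝ≥0∞ := (Metric.ball x₀ σ).indicator
      fun x => ENNReal.ofReal κ * ENNReal.ofReal (‖x - x₀‖ ^ (2 - N - γ : ℝ)) with hf₁
    set f₂ : EuclideanSpace ℝ (Fin N) → ℝ≥0∞ := (Metric.ball x₀ (b / N)).indicator
      fun x => ENNReal.ofReal (σ ^ (2 - N : ℝ)) * ENNReal.ofReal (|u x| * ρ x) with hf₂
    have hm₀ : Measurable f₀ := Measurable.indicator (by fun_prop) measurableSet_ball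
    have hm₁ : Measurable f₁ := Measurable.indicator (by fun_prop) measurableSet_ball
    have hpt : ∀ᵐ x, (Metric.ball x₀ (b / N)).indicator
        (fun x => ENNReal.ofReal (ρ x * u x * ‖x - x₀‖ ^ (2 - N : ℝ))) x ≤
          f₀ x + (f₁ x + f₂ x) := by
      filter_upwards [hρ.2, hu0, huS, hne, hne0] with x hx hux huSx hxx₀ hx0
      by_cases hxb : x ∈ Metric.ball x₀ (b / N)
      swap
      · rw [Set.indicator_of_notMem hxb]; exact zero_le
      rw [Set.indicator_of_mem hxb]
      have hρ0 : 0 ≤ ρ x := le_trans (by positivity) hx.1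
      by_cases hxσ : ‖x - x₀‖ < σ
      · have hub := hup x hxb hx0 hxx₀
        have h1 : ρ x * u x * ‖x - x₀‖ ^ (2 - N : ℝ) ≤
            κ * (if ‖x‖ < ‖x - x₀‖ then ‖x‖ ^ (2 - N - γ : ℝ) else 0) +
              κ * ‖x - x₀‖ ^ (2 - N - γ : ℝ) := by
          calc ρ x * u x * ‖x - x₀‖ ^ (2 - N : ℝ)
              ≤ (c₂ * ‖x‖ ^ (-γ)) * S * ‖x - x₀‖ ^ (2 - N : ℝ) := by
                gcongr
                exact hx.2
            _ = S * (c₂ * ‖x‖ ^ (-γ) * ‖x - x₀‖ ^ (2 - N : ℝ)) := by ring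
            _ ≤ S * _ := mul_le_mul_of_nonneg_left hub hS
            _ = _ := by rw [hκ]; ring
        calc ENNReal.ofReal (ρ x * u x * ‖x - x₀‖ ^ (2 - N : ℝ))
            ≤ ENNReal.ofReal (κ * (if ‖x‖ < ‖x - x₀‖ then ‖x‖ ^ (2 - N - γ : ℝ) else 0)) +
              ENNReal.ofReal (κ * ‖x - x₀‖ ^ (2 - N - γ : ℝ)) :=
              (ENNReal.ofReal_le_ofReal h1).trans ENNReal.ofReal_add_le
          _ ≤ f₀ x + f₁ x := by
              refine add_le_add ?_ ?_
              · by_cases hlt : ‖x‖ < ‖x - x₀‖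
                · have : x ∈ Metric.ball (0 : EuclideanSpace ℝ (Fin N)) σ := by
                    rw [mem_ball_zero_iff]; linarith
                  rw [if_pos hlt, hf₀, Set.indicator_of_mem this, sub_zero,
                    ENNReal.ofReal_mul hκ0]
                · rw [if_neg hlt]; simp
              · have : x ∈ Metric.ball x₀ σ := by rwa [Metric.mem_ball, dist_eq_norm]
                rw [hf₁, Set.indicator_of_mem this, ENNReal.ofReal_mul hκ0]
          _ ≤ f₀ x + (f₁ x + f₂ x) := by gcongr; exact le_self_add
      · have h1 : ENNReal.ofReal (ρ x * u x * ‖x - x₀‖ ^ (2 - N : ℝ)) ≤ f₂ x := by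
          rw [hf₂, Set.indicator_of_mem hxb, ← ENNReal.ofReal_mul (by positivity),
            abs_of_nonneg hux, mul_comm (u x), mul_comm (σ ^ _)]
          apply ENNReal.ofReal_le_ofReal
          gcongr ρ x * u x * ?_
          exact Real.rpow_le_rpow_of_nonpos hσ0 (not_lt.1 hxσ) (by linarith)
        exact h1.trans ((le_add_left le_rfl).trans (le_add_left le_rfl))
    have hI : ∀ y : EuclideanSpace ℝ (Fin N), ∫⁻ x, (Metric.ball y σ).indicator
        (fun x => ENNReal.ofReal κ * ENNReal.ofReal (‖x - y‖ ^ (2 - N - γ : ℝ))) x ≤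
        ENNReal.ofReal (κ * (A * σ ^ (2 - γ))) := by
      intro y
      rw [lintegral_indicator measurableSet_ball,
        lintegral_const_mul' _ _ ENNReal.ofReal_ne_top, ENNReal.ofReal_mul hκ0]
      gcongr
      exact hker y σ hσ0
    have hI₂ : ∫⁻ x, f₂ x ≤
        ENNReal.ofReal (σ ^ (2 - N : ℝ) * (2 * N * b ^ (N - 2 : ℝ) * M)) := by
      rw [hf₂, lintegral_indicator measurableSet_ball,
        lintegral_const_mul' _ _ ENNReal.ofReal_ne_top, ENNReal.ofReal_mul (by positivity)]
      gcongr
    rw [← lintegral_indicator measurableSet_ball]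
    calc _ ≤ ∫⁻ x, (f₀ x + (f₁ x + f₂ x)) := lintegral_mono_ae hpt
      _ = (∫⁻ x, f₀ x) + ((∫⁻ x, f₁ x) + ∫⁻ x, f₂ x) := by
          rw [lintegral_add_left hm₀, lintegral_add_left hm₁]
      _ ≤ ENNReal.ofReal (κ * (A * σ ^ (2 - γ))) + (ENNReal.ofReal (κ * (A * σ ^ (2 - γ))) +
          ENNReal.ofReal (σ ^ (2 - N : ℝ) * (2 * N * b ^ (N - 2 : ℝ) * M))) := by
          gcongr
          · exact hI 0
          · exact hI x₀
      _ = ENNReal.ofReal (κ * (A * σ ^ (2 - γ)) + (κ * (A * σ ^ (2 - γ)) +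
          σ ^ (2 - N : ℝ) * (2 * N * b ^ (N - 2 : ℝ) * M))) := by
          rw [ENNReal.ofReal_add (by positivity) (by positivity),
            ENNReal.ofReal_add (by positivity) (by positivity)]
      _ ≤ _ := by
          apply ENNReal.ofReal_le_ofReal
          -- the choice `σ = b τ` cancels all powers of `b`
          have e1 : b ^ (γ - 2) * b ^ (2 - γ) = 1 := by
            rw [← Real.rpow_add hb0]; simp
          have e2 : b ^ (2 - N : ℝ) * b ^ (N - 2 : ℝ) = 1 := by
            rw [← Real.rpow_add hb0]; simp
          have e3 : κ * (A * σ ^ (2 - γ)) + (κ * (A * σ ^ (2 - γ)) +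
              σ ^ (2 - N : ℝ) * (2 * N * b ^ (N - 2 : ℝ) * M)) =
              C₂ * (S * τ ^ (2 - γ)) + 2 * N * (τ ^ (2 - N : ℝ) * M) := by
            rw [hσ, Real.mul_rpow hb0.le hτ.le, Real.mul_rpow hb0.le hτ.le, hκ, hC₂]
            linear_combination 2 * S * (c₂ * 2 ^ γ) * A * τ ^ (2 - γ) * e1 +
              2 * N * τ ^ (2 - N : ℝ) * M * e2
          rw [e3, mul_add]
          gcongr <;> linarith

/-! ### The bound on the supremum -/

/-- Absorption of the supremum: of the two terms on the right of the inequality for `S ^ m`, the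
larger one determines which of the two terms bounds `S`. -/
lemma le_of_rpow_le {S M Λ K m θ : ℝ} (hS : 0 < S) (hM : 0 < M) (hΛ : 0 < Λ) (hK : 0 < K)
    (hm : 1 < m) (hθ : 0 < θ)
    (h : S ^ m ≤ K * (S ^ (m - 1) * M + 2 * Λ * (S * (M / S) ^ θ))) :
    S ≤ (2 * K + (4 * K) ^ (m - 1 + θ)⁻¹) *
      (Λ ^ (m - 1 + θ)⁻¹ * M ^ (θ * (m - 1 + θ)⁻¹) + M) := by
  set l : ℝ := (m - 1 + θ)⁻¹ with hl
  have hl0 : 0 < m - 1 + θ := by linarith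
  have hsm : S ^ m = S ^ (m - 1) * S := by
    rw [← Real.rpow_add_one hS.ne']; congr 1; ring
  rcases le_total (2 * Λ * (S * (M / S) ^ θ)) (S ^ (m - 1) * M) with h1 | h1
  · have h2 : S ^ (m - 1) * S ≤ S ^ (m - 1) * (2 * K * M) := by
      rw [← hsm]; nlinarith
    have h3 : S ≤ 2 * K * M := le_of_mul_le_mul_left h2 (by positivity)
    have h4 : 0 ≤ 2 * K * (Λ ^ l * M ^ (θ * l)) := by positivity
    have h5 : 0 ≤ (4 * K) ^ l * (Λ ^ l * M ^ (θ * l) + M) := by positivity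
    linarith
  · have h2 : S ^ m ≤ 4 * K * Λ * (S * (M / S) ^ θ) := by nlinarith
    have h3 : S ^ (m - 1 + θ) ≤ 4 * K * Λ * M ^ θ := by
      rw [Real.div_rpow hM.le hS.le, hsm] at h2
      have h4 : S ^ (m - 1) * S * S ^ θ ≤ 4 * K * Λ * M ^ θ * S := by
        calc S ^ (m - 1) * S * S ^ θ ≤ 4 * K * Λ * (S * (M ^ θ / S ^ θ)) * S ^ θ := by gcongr
          _ = _ := by field_simp
      rw [Real.rpow_add hS]
      refine le_of_mul_le_mul_right (le_trans (le_of_eq ?_) h4) hS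
      ring
    have h4 : S ≤ (4 * K) ^ l * (Λ ^ l * M ^ (θ * l)) := by
      calc S = (S ^ (m - 1 + θ)) ^ l := by rw [hl, Real.rpow_rpow_inv hS.le hl0.ne']
        _ ≤ (4 * K * Λ * M ^ θ) ^ l := by
          gcongr
        _ = _ := by
          rw [Real.mul_rpow (by positivity) (by positivity),
            Real.mul_rpow (by positivity) hΛ.le, ← Real.rpow_mul hM.le, mul_assoc]
    have h5 : 0 ≤ 2 * K * (Λ ^ l * M ^ (θ * l) + M) := by positivity
    have h6 : 0 ≤ (4 * K) ^ l * M := by positivity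
    linarith

lemma lam_eq_inv {N : ℕ} {m γ : ℝ} (hNγ : 0 < (N : ℝ) - γ) :
    lam N m γ = (m - 1 + theta N γ)⁻¹ := by
  unfold lam theta
  rw [← inv_div]
  congr 1
  field_simp
  ring

/-- The bound on the essential supremum of `u` in terms of any `M > 0` dominating `‖u‖_{0,ρ}`. -/
lemma exists_sup_bound {N : ℕ} (hN : 3 ≤ N) {m γ c₁ c₂ : ℝ} (hm : 1 < m)
    (hγ0 : 0 ≤ γ) (hγ2 : γ < 2) (hc₁ : 0 < c₁) (hc₂ : 0 < c₂) :
    ∃ C : ℝ, 0 < C ∧ ∀ ρ : EuclideanSpace ℝ (Fin N) → ℝ, IsWeight γ c₁ c₂ ρ →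
      ∀ u : EuclideanSpace ℝ (Fin N) → ℝ, MemLp u ∞ volume → (∀ᵐ x, 0 ≤ u x) →
      ∀ g : EuclideanSpace ℝ (Fin N) → ℝ, IsWeakLaplacian (fun x => u x ^ m) g →
      ∀ Λ : ℝ, 0 < Λ → (∀ᵐ x, -(Λ * ρ x * u x) ≤ g x) →
      ∀ M : ℝ, 0 < M → norm0 γ ρ u ≤ ENNReal.ofReal M →
        (eLpNorm u ∞ volume).toReal ≤
          C * (Λ ^ lam N m γ * M ^ (theta N γ * lam N m γ) + M) := by
  obtain ⟨C₁, hC₁, hmean⟩ := exists_pointwise_mean_value hN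
  obtain ⟨C₂, hC₂, hloc⟩ := exists_local_estimates hN hγ0 hγ2 hc₁ hc₂
  have hN' : (3 : ℝ) ≤ N := by exact_mod_cast hN
  have hNγ : 0 < (N : ℝ) - γ := by linarith
  have hθ : 0 < theta N γ := div_pos (by linarith) hNγ
  rw [lam_eq_inv hNγ]
  set K : ℝ := C₁ * C₂ with hK
  have hK0 : 0 < K := by positivity
  refine ⟨2 * K + (4 * K) ^ (m - 1 + theta N γ)⁻¹, by positivity, ?_⟩
  intro ρ hρ u hu hu0 g hg Λ hΛ hge M hM hnorm
  set S : ℝ := (eLpNorm u ∞ volume).toReal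
  have hS_nonneg : 0 ≤ S := ENNReal.toReal_nonneg
  rcases hS_nonneg.eq_or_lt with hS0 | hS0
  · rw [← hS0]
    positivity
  have huS : ∀ᵐ x, u x ≤ S := by
    filter_upwards [ae_le_eLpNormEssSup (f := u) (μ := volume)] with x hx
    rw [← eLpNorm_exponent_top] at hx
    have := ENNReal.toReal_mono hu.2.ne hx
    rw [toReal_enorm] at this
    exact (le_abs_self _).trans this
  -- the splitting radius that balances the two parts of the potential: `M = S τ ^ (N - γ)`
  set τ : ℝ := (M / S) ^ ((N : ℝ) - γ)⁻¹ with hτ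
  have hτ0 : 0 < τ := by positivity
  have hτθ : τ ^ (2 - γ) = (M / S) ^ theta N γ := by
    rw [hτ, ← Real.rpow_mul (by positivity), theta]
    congr 1; field_simp
  have hτM : τ ^ (2 - N : ℝ) * M = S * (M / S) ^ theta N γ := by
    have h1 : τ ^ ((N : ℝ) - γ) = M / S := Real.rpow_inv_rpow (by positivity) hNγ.ne'
    have h2 : M = τ ^ ((N : ℝ) - γ) * S := by rw [h1]; field_simp
    rw [← hτθ]
    nth_rw 1 [h2]
    rw [← mul_assoc, ← Real.rpow_add hτ0, mul_comm]
    congr 2; ring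
  have hρ0 : ∀ᵐ x, 0 ≤ ρ x := by
    filter_upwards [hρ.2] with x hx
    exact le_trans (by positivity) hx.1
  have hw0 : ∀ᵐ x, 0 ≤ u x ^ m := by
    filter_upwards [hu0] with x hx using Real.rpow_nonneg hx m
  have hF0 : ∀ᵐ x, 0 ≤ Λ * ρ x * u x := by
    filter_upwards [hu0, hρ0] with x hx hx'
    positivity
  have hwle : ∀ᵐ x, u x ^ m ≤ S ^ (m - 1) * u x := by
    filter_upwards [hu0, huS] with x hx hxS
    rcases hx.eq_or_lt with h0 | h0
    · rw [← h0, Real.zero_rpow (by linarith), mul_zero]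
    · calc u x ^ m = u x ^ (m - 1) * u x := by
            rw [← Real.rpow_add_one h0.ne']; congr 1; ring
        _ ≤ _ := by
          gcongr
  have huloc : LocallyIntegrable u volume := hu.locallyIntegrable le_top
  set X : ℝ := K * (S ^ (m - 1) * M + 2 * Λ * (S * (M / S) ^ theta N γ)) with hX
  have hX0 : 0 < X := by positivity
  have hpt : ∀ᵐ x, u x ^ m ≤ X := by
    filter_upwards [hmean _ g (fun x => Λ * ρ x * u x) hg hw0 hge hF0] with x₀ hx₀
    obtain ⟨r, hr, hr1, hr2⟩ := hloc ρ u S M hρ hS0.le hM.le hu0 huS hnorm x₀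
    have hP : ∫⁻ x in Metric.ball x₀ r,
        ENNReal.ofReal (Λ * ρ x * u x * ‖x - x₀‖ ^ (2 - N : ℝ)) ≤
          ENNReal.ofReal (Λ * (C₂ * (S * τ ^ (2 - γ) + τ ^ (2 - N : ℝ) * M))) := by
      rw [ENNReal.ofReal_mul hΛ.le]
      refine le_trans (le_of_eq ?_) (mul_le_mul_right (hr2 τ hτ0) _)
      rw [← lintegral_const_mul' _ _ ENNReal.ofReal_ne_top]
      refine lintegral_congr fun x => ?_
      rw [← ENNReal.ofReal_mul hΛ.le]
      congr 1; ring
    have hbd := hx₀ r _ hr (by positivity) hP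
    have hball : ∀ {f : EuclideanSpace ℝ (Fin N) → ℝ}, LocallyIntegrable f volume →
        IntegrableOn f (Metric.ball x₀ r) := fun hf =>
      (hf.integrableOn_isCompact (isCompact_closedBall x₀ r)).mono_set Metric.ball_subset_closedBall
    have hint : ∫ x in Metric.ball x₀ r, u x ^ m ≤
        S ^ (m - 1) * ∫ x in Metric.ball x₀ r, u x := by
      rw [← integral_const_mul]
      exact integral_mono_ae (hball hg.1) ((hball huloc).const_mul _) (ae_restrict_of_ae hwle)
    calc u x₀ ^ m ≤ _ := hbd
      _ ≤ C₁ * (r ^ (-(N : ℝ)) * (S ^ (m - 1) * ∫ x in Metric.ball x₀ r, u x) +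
          Λ * (C₂ * (S * τ ^ (2 - γ) + τ ^ (2 - N : ℝ) * M))) := by gcongr
      _ = C₁ * (S ^ (m - 1) * (r ^ (-(N : ℝ)) * ∫ x in Metric.ball x₀ r, u x) +
          Λ * (C₂ * (S * τ ^ (2 - γ) + τ ^ (2 - N : ℝ) * M))) := by ring
      _ ≤ C₁ * (S ^ (m - 1) * (C₂ * M) +
          Λ * (C₂ * (S * τ ^ (2 - γ) + τ ^ (2 - N : ℝ) * M))) := by gcongr
      _ = X := by rw [hτM, hτθ, hX, hK]; ring
  have hSX : S ^ m ≤ X := by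
    have h1 : eLpNorm u ∞ volume ≤ ENNReal.ofReal (X ^ m⁻¹) := by
      rw [eLpNorm_exponent_top]
      refine eLpNormEssSup_le_of_ae_bound ?_
      filter_upwards [hpt, hu0] with x hx hx0
      rw [Real.norm_of_nonneg hx0]
      calc u x = (u x ^ m) ^ m⁻¹ := (Real.rpow_rpow_inv hx0 (by linarith)).symm
        _ ≤ _ := by gcongr
    have h2 : S ≤ X ^ m⁻¹ := ENNReal.toReal_le_of_le_ofReal (by positivity) h1
    calc S ^ m ≤ (X ^ m⁻¹) ^ m := by gcongr
      _ = X := Real.rpow_inv_rpow hX0.le (by linarith)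
  exact le_of_rpow_le hS0 hM hΛ hK0 hm hθ hSX

end WeightedPME

theorem mainTheorem6 (N : ℕ) (hN : 3 ≤ N) (m γ c₁ c₂ : ℝ) (hm : 1 < m)
    (hγ0 : 0 ≤ γ) (hγ2 : γ < 2) (hc₁ : 0 < c₁) (hc₂ : 0 < c₂) :
    ∃ C₀ : ℝ, 0 < C₀ ∧
      ∀ (ρ : EuclideanSpace ℝ (Fin N) → ℝ), WeightedPME.IsWeight γ c₁ c₂ ρ →
      ∀ (u : EuclideanSpace ℝ (Fin N) → ℝ), MemLp u ∞ volume → (∀ᵐ x, 0 ≤ u x) →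
      ∀ (G : EuclideanSpace ℝ (Fin N) → EuclideanSpace ℝ (Fin N)),
        WeightedPME.IsWeakGradient (fun x => u x ^ m) G → WeightedPME.MemL2Loc G →
      ∀ (g : EuclideanSpace ℝ (Fin N) → ℝ),
        WeightedPME.IsWeakLaplacian (fun x => u x ^ m) g →
      ∀ (Λ : ℝ), 0 < Λ → (∀ᵐ x, -(Λ * ρ x * u x) ≤ g x) →
        eLpNorm u ∞ volume ≤
          ENNReal.ofReal C₀ *
            (ENNReal.ofReal Λ ^ WeightedPME.lam N m γ *
                WeightedPME.norm0 γ ρ u ^ (WeightedPME.theta N γ * WeightedPME.lam N m γ) +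
              WeightedPME.norm0 γ ρ u) := by
  obtain ⟨C, hC, hbound⟩ := WeightedPME.exists_sup_bound hN hm hγ0 hγ2 hc₁ hc₂
  refine ⟨C, hC, fun ρ hρ u hu hu0 G _ _ g hg Λ hΛ hge => ?_⟩
  have hN' : (3 : ℝ) ≤ N := by exact_mod_cast hN
  have hNγ : 0 < (N : ℝ) - γ := by linarith
  have hθ : 0 < WeightedPME.theta N γ := div_pos (by linarith) hNγ
  have hl : 0 < WeightedPME.lam N m γ := by
    rw [WeightedPME.lam_eq_inv hNγ]
    exact inv_pos.2 (by linarith)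
  set θ := WeightedPME.theta N γ
  set l := WeightedPME.lam N m γ
  by_cases hn : WeightedPME.norm0 γ ρ u = ⊤
  · rw [hn, add_top, ENNReal.mul_top (by simpa using hC)]
    exact le_top
  obtain ⟨n, hn0, hnn⟩ : ∃ n : ℝ, 0 ≤ n ∧ WeightedPME.norm0 γ ρ u = ENNReal.ofReal n :=
    ⟨_, ENNReal.toReal_nonneg, (ENNReal.ofReal_toReal hn).symm⟩
  -- letting `M` decrease to the norm covers the case where the norm vanishes
  have hlim : (eLpNorm u ∞ volume).toReal ≤ C * (Λ ^ l * n ^ (θ * l) + n) := by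
    have hcont : Continuous fun M : ℝ => C * (Λ ^ l * M ^ (θ * l) + M) := by
      have : Continuous fun M : ℝ => M ^ (θ * l) := Real.continuous_rpow_const (by positivity)
      fun_prop
    refine ge_of_tendsto (hcont.continuousWithinAt (s := Set.Ioi n) (x := n)) ?_
    filter_upwards [self_mem_nhdsWithin] with M hM
    have hM' : n < M := hM
    exact hbound ρ hρ u hu hu0 g hg Λ hΛ hge M (by linarith)
      (hnn.trans_le (ENNReal.ofReal_le_ofReal hM'.le))
  rw [hnn, ENNReal.ofReal_rpow_of_pos hΛ, ENNReal.ofReal_rpow_of_nonneg hn0 (by positivity),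
    ← ENNReal.ofReal_mul (by positivity), ← ENNReal.ofReal_add (by positivity) hn0,
    ← ENNReal.ofReal_mul hC.le]
  exact (ENNReal.le_ofReal_iff_toReal_le hu.2.ne (by positivity)).2 hlim
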